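/- Let $d\ge 2$, let $\mathcal B=\bigotimes_{\mathbb Z}M_d(\mathbb C)$ be the UHF $C^*$-algebra over the lattice $\mathbb Z$, let $\mathcal B_R$ and $\mathcal B_L$ be the $C^*$-subalgebras generated by the tensor factors at the sites $n\ge 0$ and $n<0$ respectively, and let $\theta$ be the translation automorphism of $\mathcal B$, which moves the tensor factor at site $n$ to site $n+1$. Let $\omega$ be a state on $\mathcal B$ with $\omega\circ\theta=\omega$, let $(\mathcal H,\pi,\Omega)$ be its GNS representation, and let $S$ be the unitary on $\mathcal H$ with $S\pi(x)\Omega=\pi(\theta(x))\Omega$ for $x\in\mathcal B$. For a projection $P$ on $\mathcal H$ put $P_n=S^nPS^{-n}$, $n\in\mathbb Z$. Let $E=[\pi(\mathcal B_R)'\Omega]$ be the orthogonal projection onto the closed span of $\pi(\mathcal B_R)'\Omega$, which is the support projection of $\omega$ in $\pi(\mathcal B_R)''$, and let $F=[\pi(\mathcal B_L)''\Omega]$ be the orthogonal projection onto the closed span of $\pi(\mathcal B_L)''\Omega$. For $P\in\{E,F\}$, a cardinal $\kappa$ is called the Mackey index of the shift with respect to the filtration $(P_n)_{n\in\mathbb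 Z}$ if there is a unitary from $\{\Omega\}^\perp$ onto a direct sum of $\kappa$ copies of $\ell^2(\mathbb Z)$ that takes the restriction of $S$ to the direct sum of $\kappa$ copies of the standard shift $\delta_m\mapsto\delta_{m+1}$ and, for every $n\in\mathbb Z$, takes the restriction of $P_n$ to the direct sum of $\kappa$ copies of the projection onto the closed span of $\{\delta_m: m\le n\}$. Proposition 4.1. Assume that $\omega$ has Kolmogorov's property, that is, $E_n\to|\Omega\rangle\langle\Omega|$ in the strong operator topology as $n\to-\infty$. Then the Mackey index of the shift with respect to the filtration $(E_n)$ exists, is unique, and equals $\aleph_0$. The same holds with respect to the filtration $(F_n)$. -/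

import Mathlib

open scoped ComplexOrder InnerProductSpace CStarAlgebra

noncomputable section

namespace SpinChain

/-- Configurations of the chain: a basis label in `{0, …, d - 1}` at every site of `ℤ`. -/
abbrev Conf (d : ℕ) : Type := ℤ → Fin d

/-- The Hilbert space `ℓ²(Conf d)` on which the chain algebra is realised. -/
abbrev ConfSpace (d : ℕ) : Type := lp (fun _ : Conf d => ℂ) 2

section Compose

variable {α : Type}

theorem sum_indicator_le (g : α → α) (s : Set α) (hg : Set.InjOn g s)
    (f : lp (fun _ : α => ℂ) 2) (t : Finset α) :
    ∑ a ∈ t, ‖s.indicator (fun a => f (g a)) a‖ ^ (2 : ENNReal).toReal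
      ≤ ‖f‖ ^ (2 : ENNReal).toReal := by
  classical
  have h2 : 0 < (2 : ENNReal).toReal := by norm_num
  calc ∑ a ∈ t, ‖s.indicator (fun a => f (g a)) a‖ ^ (2 : ENNReal).toReal
      = ∑ a ∈ t with a ∈ s, ‖f (g a)‖ ^ (2 : ENNReal).toReal := by
        rw [Finset.sum_filter]
        refine Finset.sum_congr rfl fun a _ => ?_
        by_cases ha : a ∈ s <;> simp [ha]
    _ = ∑ b ∈ (t.filter (· ∈ s)).image g, ‖f b‖ ^ (2 : ENNReal).toReal := by
        rw [Finset.sum_image]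
        intro a ha b hb hab
        exact hg (Finset.mem_filter.1 ha).2 (Finset.mem_filter.1 hb).2 hab
    _ ≤ _ := lp.sum_rpow_le_norm_rpow h2 f _

/-- The contraction `f ↦ 1_s · (f ∘ g)` of `ℓ²(α)`, for a map `g` that is injective on `s`. -/
def partialComp (g : α → α) (s : Set α) (hg : Set.InjOn g s) :
    lp (fun _ : α => ℂ) 2 →L[ℂ] lp (fun _ : α => ℂ) 2 :=
  LinearMap.mkContinuous
    { toFun := fun f => ⟨s.indicator fun a => f (g a), memℓp_gen' (sum_indicator_le g s hg f)⟩
      map_add' := fun f f' => by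
        ext a
        exact congrFun (Set.indicator_add s (fun a => f (g a)) fun a => f' (g a)) a
      map_smul' := fun c f => by
        ext a
        by_cases ha : a ∈ s <;> simp [ha] }
    1 fun f => by
      rw [one_mul]
      exact lp.norm_le_of_forall_sum_le (by norm_num) (norm_nonneg f) (sum_indicator_le g s hg f)

theorem partialComp_apply (g : α → α) (s : Set α) (hg : Set.InjOn g s)
    (f : lp (fun _ : α => ℂ) 2) (a : α) :
    partialComp g s hg f a = s.indicator (fun a => f (g a)) a := rfl

theorem norm_partialComp_apply_le (g : α → α) (s : Set α) (hg : Set.InjOn g s)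
    (f : lp (fun _ : α => ℂ) 2) :
    ‖partialComp g s hg f‖ ≤ ‖f‖ :=
  lp.norm_le_of_forall_sum_le (by norm_num) (norm_nonneg f) (sum_indicator_le g s hg f)

/-- The unitary `f ↦ f ∘ e` of `ℓ²(α)` given by a bijection `e` of `α`. -/
def compUnitary (e : Equiv.Perm α) : lp (fun _ : α => ℂ) 2 ≃ₗᵢ[ℂ] lp (fun _ : α => ℂ) 2 where
  toFun := partialComp e Set.univ e.injective.injOn
  map_add' := map_add _
  map_smul' := map_smul _
  invFun := partialComp e.symm Set.univ e.symm.injective.injOn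
  left_inv f := by ext a; simp [partialComp_apply]
  right_inv f := by ext a; simp [partialComp_apply]
  norm_map' f := by
    refine le_antisymm (norm_partialComp_apply_le e Set.univ e.injective.injOn f) ?_
    have h : partialComp e.symm Set.univ e.symm.injective.injOn
        (partialComp e Set.univ e.injective.injOn f) = f := by
      ext a; simp [partialComp_apply]
    have h' := norm_partialComp_apply_le e.symm Set.univ e.symm.injective.injOn
      (partialComp e Set.univ e.injective.injOn f)
    rw [h] at h'
    exact h'

@[simp]
theorem compUnitary_apply (e : Equiv.Perm α) (f : lp (fun _ : α => ℂ) 2) (a : α) :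
    compUnitary e f a = f (e a) := by
  change partialComp e Set.univ e.injective.injOn f a = _
  simp [partialComp_apply]

@[simp]
theorem compUnitary_symm_apply (e : Equiv.Perm α) (f : lp (fun _ : α => ℂ) 2) (a : α) :
    (compUnitary e).symm f a = f (e.symm a) := by
  change partialComp e.symm Set.univ e.symm.injective.injOn f a = _
  simp [partialComp_apply]

end Compose

section Site

variable {d : ℕ}

theorem update_injOn (n : ℤ) (i j : Fin d) :
    Set.InjOn (fun σ : Conf d => Function.update σ n j) {σ | σ n = i} := by
  intro σ hσ τ hτ h
  ext k
  by_cases hk : k = n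
  · subst hk
    rw [Set.mem_ofPred_eq] at hσ hτ
    rw [hσ, hτ]
  · have := congrFun h k
    simp only [Function.update_of_ne hk] at this
    rw [this]

/-- The matrix `A` acting on the tensor factor at site `n`; see `siteOp_apply`. -/
def siteOp (n : ℤ) (A : Matrix (Fin d) (Fin d) ℂ) : ConfSpace d →L[ℂ] ConfSpace d :=
  ∑ i, ∑ j, A i j •
    partialComp (fun σ : Conf d => Function.update σ n j) {σ | σ n = i} (update_injOn n i j)

theorem lp_sum_apply {α ι : Type} (t : Finset ι) (f : ι → lp (fun _ : α => ℂ) 2) (a : α) :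
    (∑ i ∈ t, f i) a = ∑ i ∈ t, f i a := by
  classical
  induction t using Finset.induction_on with
  | empty => simp
  | insert i t hi ih => rw [Finset.sum_insert hi, Finset.sum_insert hi, ← ih]; rfl

/-- `(A_n f)(σ) = ∑ j, A_{σ(n), j} f(σ with σ(n) replaced by j)`, so `A_n` is `A` in the `n`-th
tensor factor and the identity in all others. -/
theorem siteOp_apply (n : ℤ) (A : Matrix (Fin d) (Fin d) ℂ) (f : ConfSpace d) (σ : Conf d) :
    siteOp n A f σ = ∑ j, A (σ n) j * f (Function.update σ n j) := by
  simp only [siteOp, _root_.sum_apply, lp_sum_apply, _root_.smul_apply,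
    lp.coeFn_smul, Pi.smul_apply, partialComp_apply, smul_eq_mul]
  rw [Finset.sum_eq_single (σ n)]
  · simp
  · intro i _ hi
    simp [Set.indicator, hi.symm]
  · simp

open scoped Classical in
theorem siteOp_single (n : ℤ) (A : Matrix (Fin d) (Fin d) ℂ) (σ τ : Conf d) :
    siteOp n A (lp.single 2 σ 1) τ = if Function.update τ n (σ n) = σ then A (τ n) (σ n) else 0 := by
  rw [siteOp_apply, Finset.sum_eq_single (σ n)]
  · by_cases h : Function.update τ n (σ n) = σ
    · simp [h]
    · simp [h]
  · intro j _ hj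
    rw [lp.single_apply_ne, mul_zero]
    intro h
    exact hj (by rw [← h]; simp)
  · simp

theorem siteOp_star (n : ℤ) (A : Matrix (Fin d) (Fin d) ℂ) :
    siteOp n (star A) = star (siteOp n A) := by
  classical
  refine lp.ext_continuousLinearMap (𝕜 := ℂ) (by norm_num) fun σ => ?_
  ext τ
  simp only [ContinuousLinearMap.comp_apply, lp.singleContinuousLinearMap_apply]
  rw [siteOp_single]
  have h1 : (star (siteOp n A) (lp.single 2 σ (1 : ℂ)) : ConfSpace d) τ
      = ⟪(lp.single 2 τ (1 : ℂ) : ConfSpace d), star (siteOp n A) (lp.single 2 σ (1 : ℂ))⟫_ℂ := by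
    rw [lp.inner_single_left]; simp
  rw [h1, ContinuousLinearMap.star_eq_adjoint, ContinuousLinearMap.adjoint_inner_right,
    lp.inner_single_right, siteOp_single]
  have h2 : Function.update σ n (τ n) = τ ↔ Function.update τ n (σ n) = σ := by
    constructor
    · intro h; rw [← h]; simp
    · intro h; rw [← h]; simp
  by_cases h : Function.update τ n (σ n) = σ
  · rw [if_pos h, if_pos (h2.2 h)]
    simp [Matrix.star_apply]
  · rw [if_neg h, if_neg (fun h' => h (h2.1 h'))]
    simp

/-- The embedding of the matrix algebra as the tensor factor at site `n`. -/
def siteRep (n : ℤ) : Matrix (Fin d) (Fin d) ℂ →⋆ₐ[ℂ] (ConfSpace d →L[ℂ] ConfSpace d) where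
  toFun := siteOp n
  map_one' := by
    ext f σ
    rw [siteOp_apply]
    simp [Matrix.one_apply]
  map_mul' A B := by
    ext f σ
    simp only [mul_apply_eq_comp, siteOp_apply, Matrix.mul_apply,
      Function.update_self, Function.update_idem, Finset.sum_mul, Finset.mul_sum, mul_assoc]
    exact Finset.sum_comm
  map_zero' := by ext f σ; simp [siteOp_apply]
  map_add' A B := by ext f σ; simp [siteOp_apply, add_mul, Finset.sum_add_distrib]
  commutes' c := by
    ext f σ
    rw [siteOp_apply]
    simp [Algebra.algebraMap_eq_smul_one, Matrix.one_apply]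
  map_star' := siteOp_star n

theorem siteRep_commute {m n : ℤ} (h : m ≠ n) (A B : Matrix (Fin d) (Fin d) ℂ) :
    Commute (siteRep m A) (siteRep n B) := by
  ext f σ
  change siteOp m A (siteOp n B f) σ = siteOp n B (siteOp m A f) σ
  simp only [siteOp_apply, Finset.mul_sum, Function.update_of_ne h, Function.update_of_ne h.symm,
    Function.update_comm h]
  rw [Finset.sum_comm]
  exact Finset.sum_congr rfl fun _ _ => Finset.sum_congr rfl fun _ _ => by ring

theorem siteRep_injective (n : ℤ) :
    Function.Injective (siteRep n : Matrix (Fin d) (Fin d) ℂ → _) := by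
  classical
  intro A B h
  ext i j
  have := congrArg (fun T : ConfSpace d →L[ℂ] ConfSpace d =>
    T (lp.single 2 (fun _ => j) 1) (Function.update (fun _ => j) n i)) h
  change siteOp n A _ _ = siteOp n B _ _ at this
  rw [siteOp_single, siteOp_single] at this
  simpa using this

end Site

section Algebra

variable (d : ℕ)

/-- The norm-closed unital `*`-algebra generated by all sites. -/
def chainSubalgebra : StarSubalgebra ℂ (ConfSpace d →L[ℂ] ConfSpace d) :=
  (StarAlgebra.adjoin ℂ (⋃ n : ℤ, Set.range (siteRep (d := d) n))).topologicalClosure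

instance : IsClosed (chainSubalgebra d : Set (ConfSpace d →L[ℂ] ConfSpace d)) :=
  StarSubalgebra.isClosed_topologicalClosure _

/-- The UHF algebra `⊗_ℤ M_d(ℂ)`: the unital C⋆-algebra generated by mutually commuting unital
copies of `M_d(ℂ)`, one for every site of `ℤ`. Since the algebra generated by finitely many sites
is the (simple, finite-dimensional) tensor product of the corresponding copies of `M_d(ℂ)`, the
norm on the local algebra is its unique C⋆-norm, whatever faithful representation is used. -/
def Chain : Type := chainSubalgebra d

instance : CStarAlgebra (Chain d) := inferInstanceAs (CStarAlgebra (chainSubalgebra d))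

/-- The usual order of a C⋆-algebra: `x ≤ y` iff `y - x` is positive. -/
instance : PartialOrder (Chain d) := CStarAlgebra.spectralOrder (Chain d)

instance : StarOrderedRing (Chain d) := CStarAlgebra.spectralOrderedRing (Chain d)

/-- The inclusion of the chain algebra in the bounded operators on `ConfSpace d`. -/
def Chain.incl : Chain d →⋆ₐ[ℂ] (ConfSpace d →L[ℂ] ConfSpace d) := (chainSubalgebra d).subtype

theorem Chain.incl_injective : Function.Injective (Chain.incl d) := Subtype.val_injective

theorem siteRep_mem (n : ℤ) (A : Matrix (Fin d) (Fin d) ℂ) :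
    siteRep n A ∈ chainSubalgebra d :=
  StarSubalgebra.le_topologicalClosure _
    (StarAlgebra.subset_adjoin ℂ _ (Set.mem_iUnion.2 ⟨n, A, rfl⟩))

variable {d}

/-- The embedding of `M_d(ℂ)` in `⊗_ℤ M_d(ℂ)` as the tensor factor at site `n`. -/
def site (n : ℤ) : Matrix (Fin d) (Fin d) ℂ →⋆ₐ[ℂ] Chain d :=
  (siteRep n).codRestrict (chainSubalgebra d) (siteRep_mem d n)

theorem site_injective (n : ℤ) : Function.Injective (site (d := d) n) :=
  (StarAlgHom.injective_codRestrict _ _ _).2 (siteRep_injective n)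

theorem site_commute {m n : ℤ} (h : m ≠ n) (A B : Matrix (Fin d) (Fin d) ℂ) :
    Commute (site m A) (site n B) :=
  Chain.incl_injective d (siteRep_commute h A B)

/-- The C⋆-subalgebra `⊗_s M_d(ℂ)` generated by the sites in `s ⊆ ℤ`. -/
def region (d : ℕ) (s : Set ℤ) : StarSubalgebra ℂ (Chain d) :=
  (StarAlgebra.adjoin ℂ (⋃ n ∈ s, Set.range (site (d := d) n))).topologicalClosure

/-- The right half-chain algebra `B_R`, over the sites `n ≥ 0`. -/
def rightHalf (d : ℕ) : StarSubalgebra ℂ (Chain d) := region d {n | 0 ≤ n}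

/-- The left half-chain algebra `B_L`, over the sites `n < 0`. -/
def leftHalf (d : ℕ) : StarSubalgebra ℂ (Chain d) := region d {n | n < 0}

theorem region_univ : region d Set.univ = ⊤ := by
  refine SetLike.coe_injective ?_
  have hval : Topology.IsInducing (Chain.incl d) := ⟨rfl⟩
  have himg : (Chain.incl d) '' (StarAlgebra.adjoin ℂ (⋃ n ∈ (Set.univ : Set ℤ),
      Set.range (site (d := d) n)) : Set (Chain d))
      = (StarAlgebra.adjoin ℂ (⋃ n : ℤ, Set.range (siteRep (d := d) n)) : Set _) := by
    rw [← StarSubalgebra.coe_map, StarAlgHom.map_adjoin]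
    congr 2
    simp only [Set.mem_univ, Set.iUnion_true, Set.image_iUnion, ← Set.range_comp]
    rfl
  ext x
  refine iff_of_true ?_ (Set.mem_univ x)
  rw [region, StarSubalgebra.topologicalClosure_coe, hval.closure_eq_preimage_closure_image, himg]
  exact x.2

/-- The permutation of configurations that induces the translation. -/
def confShift (d : ℕ) : Equiv.Perm (Conf d) :=
  Equiv.arrowCongr (Equiv.addRight (-1 : ℤ)) (Equiv.refl _)

/-- Conjugation by the unitary that translates configurations. -/
def shiftRep (d : ℕ) :
    (ConfSpace d →L[ℂ] ConfSpace d) ≃⋆ₐ[ℂ] (ConfSpace d →L[ℂ] ConfSpace d) :=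
  (compUnitary (confShift d)).conjStarAlgEquiv

theorem shiftRep_siteRep (n : ℤ) (A : Matrix (Fin d) (Fin d) ℂ) :
    shiftRep d (siteRep n A) = siteRep (n + 1) A := by
  ext f σ
  change compUnitary (confShift d) (siteOp n A ((compUnitary (confShift d)).symm f)) σ
    = siteOp (n + 1) A f σ
  have h1 : confShift d σ n = σ (n + 1) := by simp [confShift, Equiv.arrowCongr]
  have h2 (j : Fin d) : (confShift d).symm (Function.update (confShift d σ) n j)
      = Function.update σ (n + 1) j := by
    ext k
    by_cases hk : k = n + 1
    · subst hk; simp [confShift, Equiv.arrowCongr]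
    · have hk' : k + -1 ≠ n := fun h => hk (by omega)
      simp [confShift, Equiv.arrowCongr, Function.update_of_ne hk, Function.update_of_ne hk']
  simp only [compUnitary_apply, siteOp_apply, compUnitary_symm_apply, h1, h2]

theorem shiftRep_symm_siteRep (n : ℤ) (A : Matrix (Fin d) (Fin d) ℂ) :
    (shiftRep d).symm (siteRep n A) = siteRep (n - 1) A := by
  rw [StarAlgEquiv.symm_apply_eq, shiftRep_siteRep, sub_add_cancel]

theorem map_mem_chainSubalgebra
    (φ : (ConfSpace d →L[ℂ] ConfSpace d) →⋆ₐ[ℂ] (ConfSpace d →L[ℂ] ConfSpace d))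
    (hφ : ∀ n A, φ (siteRep n A) ∈ chainSubalgebra d) {x : ConfSpace d →L[ℂ] ConfSpace d}
    (hx : x ∈ chainSubalgebra d) : φ x ∈ chainSubalgebra d := by
  have hc : Continuous φ := map_continuous φ
  have hle : chainSubalgebra d ≤ (chainSubalgebra d).comap φ := by
    refine StarSubalgebra.topologicalClosure_minimal (StarAlgebra.adjoin_le ?_) ?_
    swap
    · exact IsClosed.preimage hc (StarSubalgebra.isClosed_topologicalClosure _)
    rintro _ hy
    obtain ⟨n, A, rfl⟩ := Set.mem_iUnion.1 hy
    exact hφ n A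
  exact hle hx

/-- The translation automorphism `θ` of `⊗_ℤ M_d(ℂ)`, which moves site `n` to site `n + 1`. -/
def shift (d : ℕ) : Chain d ≃⋆ₐ[ℂ] Chain d :=
  StarAlgEquiv.ofStarAlgHom
    (((shiftRep d).toStarAlgHom.comp (Chain.incl d)).codRestrict (chainSubalgebra d) fun x =>
      map_mem_chainSubalgebra (shiftRep d).toStarAlgHom
        (fun n A => by
          change shiftRep d (siteRep n A) ∈ _
          rw [shiftRep_siteRep]; exact siteRep_mem d _ A) x.2)
    (((shiftRep d).symm.toStarAlgHom.comp (Chain.incl d)).codRestrict (chainSubalgebra d) fun x =>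
      map_mem_chainSubalgebra (shiftRep d).symm.toStarAlgHom
        (fun n A => by
          change (shiftRep d).symm (siteRep n A) ∈ _
          rw [shiftRep_symm_siteRep]; exact siteRep_mem d _ A) x.2)
    (by
      ext x
      exact Subtype.ext ((shiftRep d).symm_apply_apply (Chain.incl d x)))
    (by
      ext x
      exact Subtype.ext ((shiftRep d).apply_symm_apply (Chain.incl d x)))

@[simp]
theorem shift_site (n : ℤ) (A : Matrix (Fin d) (Fin d) ℂ) :
    shift d (site n A) = site (n + 1) A :=
  Subtype.ext (shiftRep_siteRep n A)

end Algebra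

section Projections

variable {H : Type*} [NormedAddCommGroup H] [InnerProductSpace ℂ H] [CompleteSpace H]

/-- The closed subspace `[M v]` spanned by the vectors `T v`, `T ∈ M`. -/
def cyclicSubspace (M : Set (H →L[ℂ] H)) (v : H) : Submodule ℂ H :=
  (Submodule.span ℂ ((fun T : H →L[ℂ] H => T v) '' M)).topologicalClosure

instance (M : Set (H →L[ℂ] H)) (v : H) : CompleteSpace (cyclicSubspace M v) :=
  inferInstanceAs (CompleteSpace (Submodule.topologicalClosure _))

/-- The orthogonal projection onto `[M v]`. -/
def cyclicProj (M : Set (H →L[ℂ] H)) (v : H) : H →L[ℂ] H :=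
  (cyclicSubspace M v).starProjection

/-- The filtration `n ↦ Sⁿ P S⁻ⁿ` generated by a projection `P` and a unitary `S`. -/
def filtration (S : H ≃ₗᵢ[ℂ] H) (P : H →L[ℂ] H) (n : ℤ) : H →L[ℂ] H :=
  (S ^ n).conjStarAlgEquiv P

/-- `κ` is a Mackey index of the unitary `S` and the filtration `P` on the orthogonal complement
of `v`: there is a unitary of `{v}ᗮ` onto the direct sum of `κ` copies of `ℓ²(ℤ)`, that is, onto
`ℓ²(ι × ℤ)` with `#ι = κ`, that takes `S` to the standard shift `δ_m ↦ δ_{m+1}` and, for every `n`,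
`P n` to the projection onto the span of the `δ_m` with `m ≤ n`, in every copy.
The unitary is given by the vectors `b (i, m)` that it takes to `δ_m` in the `i`-th copy. -/
def IsMackeyIndex (S : H ≃ₗᵢ[ℂ] H) (v : H) (P : ℤ → H →L[ℂ] H) (κ : Cardinal.{0}) : Prop :=
  ∃ ι : Type, Cardinal.mk ι = κ ∧ ∃ b : HilbertBasis (ι × ℤ) ℂ (ℂ ∙ v)ᗮ,
    (∀ i m, S (b (i, m) : H) = b (i, m + 1)) ∧
    ∀ n i m, P n (b (i, m) : H) = if m ≤ n then (b (i, m) : H) else 0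

/-- If `M` is a `*`-closed set of operators, then the projection onto `[M' v]` is the support
projection of the vector state of the unit vector `v` on the von Neumann algebra `M''`. -/
theorem isLeast_cyclicProj_centralizer (M : Set (H →L[ℂ] H)) (hM : ∀ T ∈ M, star T ∈ M)
    (v : H) (hv : ‖v‖ = 1) :
    IsLeast {p : H →L[ℂ] H | p ∈ Set.centralizer (Set.centralizer M) ∧ IsStarProjection p ∧
      ⟪v, p v⟫_ℂ = 1} (cyclicProj (Set.centralizer M) v) := by
  have hstar : ∀ T ∈ Set.centralizer M, star T ∈ Set.centralizer M := fun T hT => by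
    intro m hm
    have h := congrArg star (hT (star m) (hM m hm))
    simpa only [star_mul, star_star] using h.symm
  have hfix : cyclicProj (Set.centralizer M) v v = v := by
    refine Submodule.starProjection_eq_self_iff.2 (Submodule.le_topologicalClosure _ ?_)
    exact Submodule.subset_span ⟨1, Set.one_mem_centralizer, rfl⟩
  have hself : IsSelfAdjoint (cyclicProj (Set.centralizer M) v) := isSelfAdjoint_starProjection _
  have hinv : ∀ T ∈ Set.centralizer M, ∀ x ∈ cyclicSubspace (Set.centralizer M) v,
      T x ∈ cyclicSubspace (Set.centralizer M) v := by
    intro T hT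
    have hle : cyclicSubspace (Set.centralizer M) v
        ≤ (cyclicSubspace (Set.centralizer M) v).comap (T : H →ₗ[ℂ] H) := by
      refine Submodule.topologicalClosure_minimal _ ?_
        ((Submodule.isClosed_topologicalClosure _).preimage T.continuous)
      refine Submodule.span_le.2 ?_
      rintro _ ⟨R, hR, rfl⟩
      exact Submodule.le_topologicalClosure _
        (Submodule.subset_span ⟨T * R, Set.mul_mem_centralizer hT hR, rfl⟩)
    exact fun x hx => hle hx
  have hcomp : ∀ T ∈ Set.centralizer M,
      cyclicProj (Set.centralizer M) v * T * cyclicProj (Set.centralizer M) v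
        = T * cyclicProj (Set.centralizer M) v := by
    intro T hT
    ext x
    exact Submodule.starProjection_eq_self_iff.2
      (hinv T hT _ (Submodule.starProjection_apply_mem _ x))
  refine ⟨⟨?_, isStarProjection_starProjection, ?_⟩, ?_⟩
  · intro T hT
    have h := congrArg star (hcomp (star T) (hstar T hT))
    simp only [star_mul, star_star, hself.star_eq] at h
    rw [← hcomp T hT, mul_assoc, h]
  · rw [hfix, inner_self_eq_norm_sq_to_K, hv]
    simp
  · rintro q ⟨hq, hqp, hq1⟩
    have hqv : q v = v := by
      have h1 : ⟪v - q v, v - q v⟫_ℂ = 0 := by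
        have h2 : ⟪q v, v⟫_ℂ = 1 := by rw [← inner_conj_symm, hq1, map_one]
        have h3 : ⟪q v, q v⟫_ℂ = 1 := by
          have h4 : ⟪q v, q v⟫_ℂ = ⟪v, q (q v)⟫_ℂ := by
            conv_lhs => rw [← hqp.isSelfAdjoint.star_eq]
            rw [ContinuousLinearMap.star_eq_adjoint, ContinuousLinearMap.adjoint_inner_left,
              ← ContinuousLinearMap.star_eq_adjoint, hqp.isSelfAdjoint.star_eq]
          rw [h4, ← hq1]
          exact congrArg (fun T : H →L[ℂ] H => ⟪v, T v⟫_ℂ) hqp.isIdempotentElem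
        rw [inner_sub_left, inner_sub_right, inner_sub_right, hq1, h2, h3,
          inner_self_eq_norm_sq_to_K, hv]
        simp
      exact (sub_eq_zero.1 (inner_self_eq_zero.1 h1)).symm
    obtain ⟨K, hK, rfl⟩ := isStarProjection_iff_eq_starProjection.1 hqp
    refine Submodule.starProjection_le_starProjection_iff.2 ?_
    refine Submodule.topologicalClosure_minimal _ (Submodule.span_le.2 ?_)
      ?_
    swap
    · rw [← Submodule.orthogonal_orthogonal K]
      exact Submodule.isClosed_orthogonal _
    rintro _ ⟨T, hT, rfl⟩
    refine Submodule.starProjection_eq_self_iff.1 ?_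
    have h := congrArg (fun R : H →L[ℂ] H => R v) (hq T hT)
    change T (K.starProjection v) = K.starProjection (T v) at h
    rw [← h, hqv]

end Projections

section States

variable {d : ℕ} (ω : Chain d →ₚ[ℂ] ℂ)

/-- The cyclic vector `Ω` of the GNS representation. -/
def vac : ω.GNS := ((ω.toPreGNS 1 : ω.PreGNS) : UniformSpace.Completion ω.PreGNS)

/-- The linear map `x ↦ π(x) Ω`. -/
def orbit : Chain d →ₗ[ℂ] ω.GNS where
  toFun x := ω.gnsStarAlgHom x (vac ω)
  map_add' x y := by simp
  map_smul' c x := by simp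

theorem orbit_apply (x : Chain d) :
    orbit ω x = ((ω.toPreGNS x : ω.PreGNS) : UniformSpace.Completion ω.PreGNS) := by
  change ω.gnsNonUnitalStarAlgHom x (vac ω) = _
  rw [vac, PositiveLinearMap.gnsNonUnitalStarAlgHom_apply_coe]
  simp

theorem denseRange_orbit : DenseRange (orbit ω) := by
  have h : (orbit ω : Chain d → ω.GNS) = (fun y : ω.PreGNS => (y : ω.GNS)) ∘ ω.toPreGNS :=
    funext (orbit_apply ω)
  rw [h]
  exact UniformSpace.Completion.denseRange_coe.comp ω.toPreGNS.surjective.denseRange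
    (UniformSpace.Completion.continuous_coe _)

theorem inner_orbit (x y : Chain d) : ⟪orbit ω x, orbit ω y⟫_ℂ = ω (star x * y) := by
  rw [orbit_apply, orbit_apply, UniformSpace.Completion.inner_coe]
  rfl

/-- The GNS vector implements the state. -/
theorem inner_vac (x : Chain d) : ⟪vac ω, ω.gnsStarAlgHom x (vac ω)⟫_ℂ = ω x := by
  have h : vac ω = orbit ω 1 := by rw [orbit_apply]; rfl
  have := inner_orbit ω 1 x
  rw [← h, star_one, one_mul] at this
  exact this

/-- Translation invariance: `ω ∘ θ = ω`. -/
def IsTranslationInvariant : Prop := ∀ x : Chain d, ω (shift d x) = ω x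

/-- The translation as a linear equivalence. -/
def shiftLinear (d : ℕ) : Chain d ≃ₗ[ℂ] Chain d where
  toFun := shift d
  invFun := (shift d).symm
  map_add' := map_add _
  map_smul' := map_smul _
  left_inv := (shift d).symm_apply_apply
  right_inv := (shift d).apply_symm_apply

variable {ω} in
theorem norm_orbit_shift (h : IsTranslationInvariant ω) (x : Chain d) :
    ‖orbit ω (shiftLinear d x)‖ = ‖orbit ω x‖ := by
  change ‖orbit ω (shift d x)‖ = ‖orbit ω x‖
  have : ⟪orbit ω (shift d x), orbit ω (shift d x)⟫_ℂ = ⟪orbit ω x, orbit ω x⟫_ℂ := by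
    rw [inner_orbit, inner_orbit, ← map_star, ← map_mul, h]
  rw [inner_self_eq_norm_sq_to_K, inner_self_eq_norm_sq_to_K] at this
  have h2 : ‖orbit ω (shift d x)‖ ^ 2 = ‖orbit ω x‖ ^ 2 := by exact_mod_cast this
  exact (sq_eq_sq₀ (norm_nonneg _) (norm_nonneg _)).1 h2

variable {ω} in
/-- The unitary `S` that implements the translation, `S π(x) Ω = π(θ(x)) Ω`. -/
def shiftUnitary (h : IsTranslationInvariant ω) : ω.GNS ≃ₗᵢ[ℂ] ω.GNS :=
  (shiftLinear d).extendOfIsometry (orbit ω) (orbit ω)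
    (denseRange_orbit ω) (denseRange_orbit ω) (norm_orbit_shift h)

variable {ω} in
theorem shiftUnitary_orbit (h : IsTranslationInvariant ω) (x : Chain d) :
    shiftUnitary h (orbit ω x) = orbit ω (shift d x) := by
  unfold shiftUnitary
  rw [LinearEquiv.extendOfIsometry_eq]
  rfl

variable {ω} in
theorem shiftUnitary_vac (h : IsTranslationInvariant ω) : shiftUnitary h (vac ω) = vac ω := by
  have h1 : vac ω = orbit ω 1 := by rw [orbit_apply]; rfl
  rw [h1, shiftUnitary_orbit, map_one]

/-- The projection `E = [π(B_R)' Ω]`, the support projection of `ω` in `π(B_R)''`. -/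
def supportProj : ω.GNS →L[ℂ] ω.GNS :=
  cyclicProj (Set.centralizer (ω.gnsStarAlgHom '' rightHalf d)) (vac ω)

/-- The projection `F = [π(B_L)'' Ω]`. -/
def leftProj : ω.GNS →L[ℂ] ω.GNS :=
  cyclicProj (Set.centralizer (Set.centralizer (ω.gnsStarAlgHom '' leftHalf d))) (vac ω)

theorem norm_vac (h1 : ω 1 = 1) : ‖vac ω‖ = 1 := by
  have h := inner_vac ω 1
  rw [map_one, one_apply_eq_self, h1, inner_self_eq_norm_sq_to_K] at h
  have h2 : ‖vac ω‖ ^ 2 = 1 := Complex.ofReal_injective (by rw [Complex.ofReal_pow]; simpa using h)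
  exact (pow_eq_one_iff_of_nonneg (norm_nonneg _) two_ne_zero).1 h2

/-- `E` is the least projection in `π(B_R)''` to which the state gives the value `1`. -/
theorem isLeast_supportProj (h1 : ω 1 = 1) :
    IsLeast {p : ω.GNS →L[ℂ] ω.GNS |
      p ∈ Set.centralizer (Set.centralizer (ω.gnsStarAlgHom '' rightHalf d)) ∧
      IsStarProjection p ∧ ⟪vac ω, p (vac ω)⟫_ℂ = 1} (supportProj ω) := by
  refine isLeast_cyclicProj_centralizer _ ?_ _ (norm_vac ω h1)
  rintro _ ⟨x, hx, rfl⟩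
  exact ⟨star x, star_mem hx, map_star _ x⟩

variable {ω} in
/-- Kolmogorov's property: `E_n = Sⁿ E S⁻ⁿ` tends strongly to `|Ω⟩⟨Ω|` as `n → -∞`
(for a translation-invariant state, `n ↦ E_n` is automatically increasing). -/
def IsKolmogorov (h : IsTranslationInvariant ω) : Prop :=
  ∀ ψ : ω.GNS, Filter.Tendsto (fun n : ℤ => filtration (shiftUnitary h) (supportProj ω) n ψ)
    Filter.atBot (nhds (InnerProductSpace.rankOne ℂ (vac ω) (vac ω) ψ))

end States

end SpinChain

end

/-! This is a Wold decomposition. Let `K` be the range of `E` or `F`, and let `K n` be its `n`-th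
translate under `S`. The `K n` increase and all contain `Ω`. Their projections tend to the
projection onto `ℂΩ` as `n → -∞`, and their union is dense, because every local observable can be
translated into the left half-chain. Put `W = K 0 ⊖ K (-1)`. The spaces `Sᵐ W = K m ⊖ K (m - 1)` are
mutually orthogonal and together span the complement of `Ω`, so translating an orthonormal basis of
`W` gives the required unitary (`exists_isMackeyIndex`). Conversely, the vectors `b (i, 0)` of any
such unitary lie in `W` and span it topologically, so every index equals `dim W`.

It remains to see that `dim W = ℵ₀`. It is at most countable because the GNS space is separable. For
the lower bound, the matrix algebras at the sites `≤ -2` leave both `K 0` and `K (-1)` invariant,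
hence also `W`, and infinitely many commuting copies of `M_d` cannot act on a nonzero
finite-dimensional space (`eq_bot_of_finiteDimensional_of_invariant`). The case `W = 0` would make
`K n` constant, hence the whole space equal to `ℂΩ`, which the same lemma excludes.

Both filtrations are treated at once by `isMackeyIndex_cyclicProj_iff`, for `[NΩ]` with `N =
π(B_R)'` or `N = π(B_L)''`. By locality `π(B_L)'' ⊆ π(B_R)'`, so `F ≤ E` and the limit at `-∞`
passes from `E` to `F`. -/

namespace SpinChain

/-! ### Wandering subspaces: existence and size of the index for an abstract filtration -/

section Wandering

variable {H : Type*} [NormedAddCommGroup H] [InnerProductSpace ℂ H]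

/-- Distinct orthonormal vectors are at distance `√2 > 1`, so the balls of radius `1/2` around them
are disjoint, and a separable space holds only countably many of these. -/
theorem countable_of_orthonormal [TopologicalSpace.SeparableSpace H] {ι : Type*} {w : ι → H}
    (hw : Orthonormal ℂ w) : Countable ι := by
  refine Pairwise.countable_of_isOpen_disjoint (s := fun i => Metric.ball (w i) (1 / 2))
    (fun i j hij => ?_) (fun i => Metric.isOpen_ball)
    (fun i => ⟨w i, Metric.mem_ball_self (by norm_num)⟩)
  refine Metric.ball_disjoint_ball ?_
  have h : ‖w i - w j‖ * ‖w i - w j‖ = ‖w i‖ * ‖w i‖ + ‖w j‖ * ‖w j‖ := by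
    have := norm_sub_mul_self (𝕜 := ℂ) (w i) (w j)
    rw [hw.2 hij] at this
    simpa using this
  rw [hw.1 i, hw.1 j] at h
  rw [dist_eq_norm]
  nlinarith [norm_nonneg (w i - w j)]

theorem zpow_add_one_apply (S : H ≃ₗᵢ[ℂ] H) (m : ℤ) (x : H) : (S ^ (m + 1)) x = S ((S ^ m) x) := by
  rw [add_comm, zpow_one_add]
  rfl

theorem zpow_apply_mem_iff {S : H ≃ₗᵢ[ℂ] H} {K : ℤ → Submodule ℂ H}
    (hS : ∀ n x, S x ∈ K (n + 1) ↔ x ∈ K n) (m n : ℤ) (x : H) :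
    (S ^ m) x ∈ K (n + m) ↔ x ∈ K n := by
  induction m using Int.induction_on with
  | zero => simp
  | succ i ih => rw [zpow_add_one_apply, ← add_assoc, hS, ih]
  | pred i ih =>
    rw [← ih, ← hS (n + (-i - 1)), ← zpow_add_one_apply]
    ring_nf

theorem apply_mem_orthogonal_iff {S : H ≃ₗᵢ[ℂ] H} {K : ℤ → Submodule ℂ H}
    (hS : ∀ n x, S x ∈ K (n + 1) ↔ x ∈ K n) (n : ℤ) (x : H) :
    S x ∈ (K (n + 1))ᗮ ↔ x ∈ (K n)ᗮ := by
  simp only [Submodule.mem_orthogonal]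
  constructor
  · intro h u hu
    rw [← S.inner_map_map]
    exact h _ ((hS n u).2 hu)
  · intro h u hu
    have := h (S.symm u) ((hS n _).1 (by simpa using hu))
    rw [← S.inner_map_map] at this
    simpa using this

/-- The vectors `b (i, 0)` are orthonormal, which bounds the index by separability. If there were
finitely many of them, they would span the wandering space `K 0 ⊓ (K (-1))ᗮ`, which is assumed
infinite-dimensional. -/
theorem mk_eq_aleph0_of_isMackeyIndex [TopologicalSpace.SeparableSpace H] {S : H ≃ₗᵢ[ℂ] H} {v : H}
    {K : ℤ → Submodule ℂ H} [∀ n, (K n).HasOrthogonalProjection] (hvK : ∀ n, v ∈ K n)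
    (hinf : ¬ FiniteDimensional ℂ ↥(K 0 ⊓ (K (-1))ᗮ)) {κ : Cardinal.{0}}
    (h : IsMackeyIndex S v (fun n => (K n).starProjection) κ) : κ = Cardinal.aleph0 := by
  obtain ⟨ι, rfl, b, -, hb⟩ := h
  have hin : ∀ n i m, m ≤ n → (b (i, m) : H) ∈ K n := fun n i m hmn =>
    Submodule.starProjection_eq_self_iff.1 (by rw [hb, if_pos hmn])
  have hout : ∀ n i m, n < m → (b (i, m) : H) ∈ (K n)ᗮ := fun n i m hmn =>
    (Submodule.starProjection_apply_eq_zero_iff _).1 (by rw [hb, if_neg hmn.not_ge])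
  have hon : Orthonormal ℂ (fun i => (b (i, (0 : ℤ)) : H)) :=
    (b.orthonormal.comp (fun i => (i, (0 : ℤ))) fun i j hij => (Prod.ext_iff.1 hij).1).comp_linearIsometry
      (ℂ ∙ v)ᗮ.subtypeₗᵢ
  have hc : Countable ι := countable_of_orthonormal hon
  suffices Infinite ι from Cardinal.mk_eq_aleph0 ι
  by_contra hfin
  rw [not_infinite_iff_finite] at hfin
  have := Fintype.ofFinite ι
  refine hinf ?_
  have hle : K 0 ⊓ (K (-1))ᗮ ≤ Submodule.span ℂ (Set.range fun i => (b (i, (0 : ℤ)) : H)) := by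
    rintro x ⟨hx0, hx1⟩
    have hxv : x ∈ (ℂ ∙ v)ᗮ := by
      rw [Submodule.mem_orthogonal_singleton_iff_inner_right]
      exact hx1 v (hvK _)
    set y : (ℂ ∙ v)ᗮ := ⟨x, hxv⟩ with hy
    -- All coefficients of `y` off level `0` vanish: for `m < 0` the basis vector is in `K (-1)`, to
    -- which `x` is orthogonal, and for `m > 0` it is orthogonal to `K 0`, which contains `x`.
    have hz : y - ∑ i, ⟪b (i, (0 : ℤ)), y⟫_ℂ • b (i, (0 : ℤ)) = 0 := by
      refine b.repr.map_eq_zero_iff.1 ?_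
      ext ⟨j, m⟩
      rw [b.repr_apply_apply, inner_sub_right, inner_sum]
      simp only [inner_smul_right]
      rcases lt_trichotomy m 0 with hm | rfl | hm
      · have h1 : ⟪b (j, m), y⟫_ℂ = 0 := hx1 _ (hin _ _ _ (by omega))
        rw [h1, Finset.sum_eq_zero]
        · simp
        · intro i _
          rw [b.orthonormal.2 (by simp [hm.ne]), mul_zero]
      · rw [Finset.sum_eq_single j]
        · rw [inner_self_eq_norm_sq_to_K, b.orthonormal.1]
          simp
        · intro i _ hij
          rw [b.orthonormal.2 (by simp [hij.symm]), mul_zero]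
        · simp
      · have h1 : ⟪b (j, m), y⟫_ℂ = 0 := by
          rw [← inner_conj_symm]
          have : ⟪y, b (j, m)⟫_ℂ = 0 := hout _ _ _ hm x hx0
          rw [this, map_zero]
        rw [h1, Finset.sum_eq_zero]
        · simp
        · intro i _
          rw [b.orthonormal.2 (by simp [hm.ne']), mul_zero]
    have hx : x = ∑ i, ⟪b (i, (0 : ℤ)), y⟫_ℂ • (b (i, (0 : ℤ)) : H) := by
      have := congrArg (Subtype.val) (sub_eq_zero.1 hz)
      simpa [hy] using this
    rw [hx]
    exact Submodule.sum_mem _ fun i _ =>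
      Submodule.smul_mem _ _ (Submodule.subset_span ⟨i, rfl⟩)
  have : FiniteDimensional ℂ (Submodule.span ℂ (Set.range fun i => (b (i, (0 : ℤ)) : H))) :=
    FiniteDimensional.span_of_finite ℂ (Set.finite_range _)
  exact Submodule.finiteDimensional_of_le hle

/-- The basis consists of the translates `Sᵐ c i` of an orthonormal basis `c` of `W = K 0 ⊖ K (-1)`.
The limit at `-∞` and the density of the union are used only for completeness of this system. -/
theorem exists_isMackeyIndex {H : Type} [NormedAddCommGroup H] [InnerProductSpace ℂ H]
    [CompleteSpace H] {S : H ≃ₗᵢ[ℂ] H} {v : H}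
    {K : ℤ → Submodule ℂ H} [∀ n, (K n).HasOrthogonalProjection] (hvK : ∀ n, v ∈ K n)
    (hmono : Monotone K) (hS : ∀ n x, S x ∈ K (n + 1) ↔ x ∈ K n)
    (hbot : ∀ x, Filter.Tendsto (fun n : ℤ => (K n).starProjection x) Filter.atBot
      (nhds (InnerProductSpace.rankOne ℂ v v x)))
    (htop : ∀ z, (∀ n, z ∈ (K n)ᗮ) → z = 0) :
    ∃ κ, IsMackeyIndex S v (fun n => (K n).starProjection) κ := by
  have : CompleteSpace (K 0) := by
    rw [← Submodule.orthogonal_orthogonal (K 0)]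
    exact (Submodule.isClosed_orthogonal _).completeSpace_coe
  set W : Submodule ℂ H := K 0 ⊓ (K (-1))ᗮ with hW
  have : CompleteSpace W := by
    rw [hW, ← Submodule.orthogonal_orthogonal (K 0)]
    exact ((Submodule.isClosed_orthogonal _).inter
      (Submodule.isClosed_orthogonal _)).completeSpace_coe
  obtain ⟨w, c, -⟩ := exists_hilbertBasis ℂ W
  have hin : ∀ (n : ℤ) (x : W) (m : ℤ), m ≤ n → (S ^ m) (x : H) ∈ K n := fun n x m hmn =>
    hmono hmn (by simpa using (zpow_apply_mem_iff hS m 0 (x : H)).2 x.2.1)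
  have hout : ∀ (n : ℤ) (x : W) (m : ℤ), n < m → (S ^ m) (x : H) ∈ (K n)ᗮ := by
    intro n x m hmn
    refine Submodule.orthogonal_le (hmono (Int.le_sub_one_of_lt hmn)) ?_
    have := (zpow_apply_mem_iff (K := fun n => (K n)ᗮ) (apply_mem_orthogonal_iff hS) m (-1)
      (x : H)).2 x.2.2
    rwa [neg_add_eq_sub] at this
  have hv : ∀ (x : W) (m : ℤ), (S ^ m) (x : H) ∈ (ℂ ∙ v)ᗮ := fun x m => by
    rw [Submodule.mem_orthogonal_singleton_iff_inner_right]
    exact hout (m - 1) x m (by omega) v (hvK _)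
  set f : w × ℤ → (ℂ ∙ v)ᗮ := fun p => ⟨(S ^ p.2) (c p.1 : H), hv _ _⟩ with hf
  have hon : Orthonormal ℂ f := by
    refine ⟨fun p => ?_, ?_⟩
    · change ‖(S ^ p.2) (c p.1 : H)‖ = 1
      rw [LinearIsometryEquiv.norm_map]
      exact c.orthonormal.1 p.1
    · rintro ⟨i, m⟩ ⟨j, n⟩ hne
      change ⟪(S ^ m) (c i : H), (S ^ n) (c j : H)⟫_ℂ = 0
      rcases lt_trichotomy m n with hmn | rfl | hmn
      · exact hout m _ n hmn _ (hin m _ m le_rfl)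
      · rw [LinearIsometryEquiv.inner_map_map]
        exact c.orthonormal.2 fun h => hne (by rw [h])
      · rw [← inner_conj_symm, hout n _ m hmn _ (hin n _ n le_rfl), map_zero]
  have hsp : (Submodule.span ℂ (Set.range f))ᗮ = ⊥ := by
    rw [Submodule.eq_bot_iff]
    rintro ⟨x, hxv⟩ hx
    rw [Submodule.mem_orthogonal_singleton_iff_inner_right] at hxv
    -- Orthogonality to the translated basis vectors extends to all of `Sᵐ W` by linearity and
    -- continuity.
    have hx' : ∀ (y : W) (m : ℤ), ⟪(S ^ m) (y : H), x⟫_ℂ = 0 := by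
      intro y m
      have h0 : ⟪(y : H), (S ^ m).symm x⟫_ℂ = 0 := by
        have hcl : IsClosed {u : W | ⟪(u : H), (S ^ m).symm x⟫_ℂ = 0} :=
          isClosed_eq (by fun_prop) continuous_const
        have hmem : y ∈ (Submodule.span ℂ (Set.range c)).topologicalClosure := by
          rw [c.dense_span]; trivial
        refine (closure_minimal ?_ hcl) hmem
        intro u hu
        induction hu using Submodule.span_induction with
        | mem u hu =>
          obtain ⟨i, rfl⟩ := hu
          change ⟪(c i : H), (S ^ m).symm x⟫_ℂ = 0
          have := hx (f (i, m)) (Submodule.subset_span ⟨_, rfl⟩)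
          rw [← (S ^ m).inner_map_map]
          simpa using this
        | zero => simp
        | add a b _ _ ha hb =>
          change ⟪((a + b : W) : H), _⟫_ℂ = 0
          rw [Submodule.coe_add, inner_add_left, ha, hb, add_zero]
        | smul r a _ ha =>
          change ⟪((r • a : W) : H), _⟫_ℂ = 0
          rw [Submodule.coe_smul, inner_smul_left, ha, mul_zero]
      rw [← (S ^ m).inner_map_map] at h0
      simpa using h0
    -- The increment `u` lies in `K (n + 1) ⊖ K n = Sⁿ⁺¹ W`, so it is orthogonal to `x`. Since `⟪u,
    -- x⟫ = ⟪u, u⟫`, it vanishes.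
    have hstep : ∀ n, (K (n + 1)).starProjection x = (K n).starProjection x := by
      intro n
      set u := (K (n + 1)).starProjection x - (K n).starProjection x with hu
      have hu1 : u ∈ K (n + 1) := sub_mem (Submodule.starProjection_apply_mem _ _)
        (hmono (by omega) (Submodule.starProjection_apply_mem _ _))
      have hu2 : u ∈ (K n)ᗮ := by
        have h1 : x - (K (n + 1)).starProjection x ∈ (K n)ᗮ :=
          Submodule.orthogonal_le (hmono (by omega : n ≤ n + 1))
            (Submodule.sub_starProjection_mem_orthogonal _)
        have h2 : x - (K n).starProjection x ∈ (K n)ᗮ :=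
          Submodule.sub_starProjection_mem_orthogonal _
        simpa [hu] using sub_mem h2 h1
      have hux : ⟪u, x⟫_ℂ = 0 := by
        have hy : (S ^ (n + 1)).symm u ∈ W := by
          constructor
          · have := zpow_apply_mem_iff hS (n + 1) 0 ((S ^ (n + 1)).symm u)
            exact this.1 (by simpa using hu1)
          · have := zpow_apply_mem_iff (K := fun n => (K n)ᗮ) (apply_mem_orthogonal_iff hS)
              (n + 1) (-1) ((S ^ (n + 1)).symm u)
            exact this.1 (by simpa using hu2)
        simpa using hx' ⟨_, hy⟩ (n + 1)
      have huu : ⟪u, u⟫_ℂ = 0 := by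
        have h1 : ⟪u, x - (K (n + 1)).starProjection x⟫_ℂ = 0 :=
          Submodule.sub_starProjection_mem_orthogonal _ u hu1
        have h2 : ⟪u, (K n).starProjection x⟫_ℂ = 0 := by
          rw [← inner_conj_symm, hu2 _ (Submodule.starProjection_apply_mem _ _), map_zero]
        rw [inner_sub_right, hux, zero_sub, neg_eq_zero] at h1
        conv_lhs => rw [hu]
        rw [inner_sub_right, ← hu, h1, h2, sub_zero]
      exact sub_eq_zero.1 (inner_self_eq_zero.1 huu)
    have hconst : ∀ n : ℤ, (K n).starProjection x = (K 0).starProjection x := by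
      intro n
      induction n using Int.induction_on with
      | zero => rfl
      | succ i ih => rw [hstep, ih]
      | pred i ih => rw [← ih, ← hstep]; congr 3; ring_nf
    -- The constant value of the projections is their limit at `-∞`, namely `⟪v, x⟫ v`, and `x ⟂ v`.
    have hzero : (K 0).starProjection x = 0 := by
      have h1 := hbot x
      simp only [hconst] at h1
      have := tendsto_nhds_unique tendsto_const_nhds h1
      rw [this, InnerProductSpace.rankOne_apply, hxv, zero_smul]
    have hxz : x = 0 := htop x fun n => by
      rw [← Submodule.starProjection_apply_eq_zero_iff, hconst, hzero]
    exact Subtype.ext hxz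
  refine ⟨_, w, rfl, HilbertBasis.mkOfOrthogonalEqBot hon hsp, fun i m => ?_, fun n i m => ?_⟩
  · rw [HilbertBasis.coe_mkOfOrthogonalEqBot]
    exact (zpow_add_one_apply S m _).symm
  · rw [HilbertBasis.coe_mkOfOrthogonalEqBot]
    split_ifs with hmn
    · exact Submodule.starProjection_eq_self_iff.2 (hin n _ m hmn)
    · exact (Submodule.starProjection_apply_eq_zero_iff _).2 (hout n _ m (not_le.1 hmn))

end Wandering

/-! ### Commuting matrix algebras have no finite-dimensional invariant subspace -/

section Matrices

variable {d : ℕ} {H : Type*} [NormedAddCommGroup H] [InnerProductSpace ℂ H]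

/-- Infinitely many commuting unital copies of `M_d(ℂ)`, `d ≥ 2`, have no common
finite-dimensional invariant subspace but `0`. -/
theorem eq_bot_of_finiteDimensional_of_invariant (hd : 2 ≤ d)
    (ρ : ℕ → Matrix (Fin d) (Fin d) ℂ →ₐ[ℂ] (H →L[ℂ] H))
    (hρ : ∀ m n, m ≠ n → ∀ A B, Commute (ρ m A) (ρ n B)) (V : Submodule ℂ H)
    [FiniteDimensional ℂ V] (k : ℕ) (hV : ∀ n, k ≤ n → ∀ A, ∀ x ∈ V, ρ n A x ∈ V) : V = ⊥ := by
  induction hD : Module.finrank ℂ V using Nat.strong_induction_on generalizing V k with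
  | _ D ih =>
  subst hD
  have : NeZero d := ⟨by omega⟩
  set e : Fin d → Fin d → H →L[ℂ] H := fun i j => ρ k (Matrix.single i j 1) with he
  have hmul : ∀ i j l, e i j * e j l = e i l := fun i j l => by
    simp only [he, ← map_mul, Matrix.single_mul_single_same, mul_one]
  have hone : ∀ x, ∑ i, e i i x = x := fun x => by
    have : ∑ i, e i i = 1 := by
      simp only [he, ← map_sum]
      rw [← map_one (ρ k)]
      rw [Matrix.sum_single_one]
    rw [← sum_apply, this]
    rfl
  -- The corner `e 0 0 V`. It is invariant under the copies after the `k`-th, which commute with `e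
  -- 0 0`; this is why the induction on the dimension leaves `k` free.
  set V' : Submodule ℂ H := V ⊓ LinearMap.ker ((e 0 0 - 1 : H →L[ℂ] H) : H →ₗ[ℂ] H) with hV'
  have hmem : ∀ x, x ∈ V' ↔ x ∈ V ∧ e 0 0 x = x := fun x => by
    simp [hV', sub_eq_zero]
  have : FiniteDimensional ℂ V' := Submodule.finiteDimensional_of_le inf_le_left
  have hrange : ∀ i, ∀ x ∈ V, e 0 i x ∈ V' := fun i x hx => (hmem _).2
    ⟨hV k le_rfl _ x hx, by
      change (e 0 0 * e 0 i) x = _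
      rw [hmul]⟩
  -- If `e 0 0` is the identity on `V`, then `e 1 1` is zero there because `d ≥ 2`. Hence so is `e 0
  -- 1 = e 0 1 * e 1 1`, and `x = e 0 0 x = e 0 1 (e 1 0 x) = 0`.
  by_cases hlt : V' = V
  · rw [Submodule.eq_bot_iff]
    intro x hx
    set i : Fin d := ⟨1, by omega⟩
    have hi : i ≠ 0 := by
      intro h
      simpa [i] using congrArg Fin.val h
    have hker : ∀ y ∈ V, e 0 i y = 0 := by
      intro y hy
      have h1 : e i 0 (e 0 i y) = e i i y := by
        exact (congrArg (fun T : H →L[ℂ] H => T y) (hmul i 0 i))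
      have h2 : e 0 0 (e i i y) = e i i y :=
        ((hmem _).1 (hlt ▸ hV k le_rfl _ y hy : e i i y ∈ V')).2
      have h3 : e 0 0 (e i i y) = 0 := by
        change (e 0 0 * e i i) y = 0
        simp only [he, ← map_mul]
        rw [Matrix.single_mul_single_of_ne (h := hi.symm)]
        simp
      have h4 : e i i y = 0 := by rw [← h2, h3]
      rw [← hmul 0 i i]
      change e 0 i (e i i y) = 0
      rw [h4, map_zero]
    have h5 : e 0 0 x = x := ((hmem _).1 (hlt ▸ hx : x ∈ V')).2
    rw [← h5, ← hmul 0 i 0]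
    exact hker _ (hV k le_rfl _ x hx)
  -- Otherwise the corner is smaller, hence zero by induction, and `x = ∑ i, e i 0 (e 0 i x)` with
  -- every `e 0 i x` in the corner.
  · have hlt' : Module.finrank ℂ V' < Module.finrank ℂ V :=
      Submodule.finrank_lt_finrank_of_lt (lt_of_le_of_ne inf_le_left hlt)
    have hbot : V' = ⊥ := by
      refine ih _ hlt' V' (k + 1) (fun n hn A x hx => ?_) rfl
      obtain ⟨hx1, hx2⟩ := (hmem x).1 hx
      refine (hmem _).2 ⟨hV n (by omega) A x hx1, ?_⟩
      have hc : e 0 0 * ρ n A = ρ n A * e 0 0 := hρ k n (by omega) _ A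
      change (e 0 0 * ρ n A) x = _
      rw [hc]
      exact congrArg (ρ n A) hx2
    rw [Submodule.eq_bot_iff]
    intro x hx
    rw [← hone x]
    refine Finset.sum_eq_zero fun i _ => ?_
    have h0 : e 0 i x = 0 := by
      have := hrange i x hx
      rwa [hbot, Submodule.mem_bot] at this
    rw [← hmul i 0 i]
    change e i 0 (e 0 i x) = 0
    rw [h0, map_zero]

end Matrices

/-! ### Separability of the chain algebra and of the GNS space -/

section Separable

variable {d : ℕ}

/-- The matrix units at all sites are countably many, so they generate a countable monoid. Its
linear span contains every site algebra, hence the dense local algebra. -/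
theorem separableSpace_chain (d : ℕ) : TopologicalSpace.SeparableSpace (Chain d) := by
  set U : Set (Chain d) := Set.range fun p : ℤ × Fin d × Fin d =>
    site p.1 (Matrix.single p.2.1 p.2.2 1) with hU
  set M : Submodule ℂ (Chain d) := Submodule.span ℂ (Submonoid.closure U : Set (Chain d)) with hM
  have hMA : M = Subalgebra.toSubmodule (Algebra.adjoin ℂ U) := Algebra.adjoin_eq_span ℂ U |>.symm
  have hcount : (Submonoid.closure U : Set (Chain d)).Countable := by
    have : Countable U := (Set.countable_range _).to_subtype
    rw [Submonoid.closure_eq_mrange, MonoidHom.coe_mrange]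
    have : Countable (FreeMonoid U) := inferInstanceAs (Countable (List U))
    exact Set.countable_range _
  have hsep : TopologicalSpace.IsSeparable (M : Set (Chain d)) := hcount.isSeparable.span
  have hsite : ∀ n (A : Matrix (Fin d) (Fin d) ℂ), site n A ∈ Algebra.adjoin ℂ U := by
    intro n A
    rw [Matrix.matrix_eq_sum_single A, map_sum]
    refine Subalgebra.sum_mem _ fun i _ => ?_
    rw [map_sum]
    refine Subalgebra.sum_mem _ fun j _ => ?_
    rw [← mul_one (A i j), ← smul_eq_mul, ← Matrix.smul_single, map_smul]
    exact Subalgebra.smul_mem _ (Algebra.subset_adjoin (Set.mem_range_self (n, i, j))) _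
  have hle : (StarAlgebra.adjoin ℂ (⋃ n ∈ (Set.univ : Set ℤ), Set.range (site (d := d) n)) :
      Set (Chain d)) ⊆ M := by
    intro x hx
    rw [hMA]
    refine Algebra.adjoin_le ?_ hx
    rintro y (hy | hy)
    · simp only [Set.mem_iUnion] at hy
      obtain ⟨n, -, A, rfl⟩ := hy
      exact hsite n A
    · rw [Set.mem_star] at hy
      simp only [Set.mem_iUnion] at hy
      obtain ⟨n, -, A, hA⟩ := hy
      rw [← star_star y, ← hA, ← map_star]
      exact hsite n _
  rw [← TopologicalSpace.isSeparable_univ_iff]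
  refine hsep.closure.mono fun x _ => closure_mono hle ?_
  rw [← StarSubalgebra.topologicalClosure_coe]
  change x ∈ region d Set.univ
  rw [region_univ]
  trivial

theorem continuous_orbit (ω : Chain d →ₚ[ℂ] ℂ) : Continuous (orbit ω) := by
  change Continuous fun x => ω.gnsStarAlgHom x (vac ω)
  have : Continuous (ω.gnsStarAlgHom) := map_continuous _
  fun_prop

theorem separableSpace_gns (ω : Chain d →ₚ[ℂ] ℂ) : TopologicalSpace.SeparableSpace ω.GNS :=
  have := separableSpace_chain d
  (denseRange_orbit ω).separableSpace (continuous_orbit ω)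

end Separable

/-! ### Translation covariance and locality of the half-chains -/

section Covariance

variable {d : ℕ} {ω : Chain d →ₚ[ℂ] ℂ}

theorem shiftUnitary_gns (h : IsTranslationInvariant ω) (x : Chain d) (ψ : ω.GNS) :
    shiftUnitary h (ω.gnsStarAlgHom x ψ) = ω.gnsStarAlgHom (shift d x) (shiftUnitary h ψ) := by
  have horb : ∀ a b, ω.gnsStarAlgHom a (orbit ω b) = orbit ω (a * b) := fun a b => by
    change _ = ω.gnsStarAlgHom (a * b) (vac ω)
    rw [map_mul]
    rfl
  refine congrFun ((denseRange_orbit ω).equalizer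
    (g := fun ψ => shiftUnitary h (ω.gnsStarAlgHom x ψ))
    (h := fun ψ => ω.gnsStarAlgHom (shift d x) (shiftUnitary h ψ)) (by fun_prop) (by fun_prop) ?_) ψ
  ext y
  simp only [Function.comp_apply, horb, shiftUnitary_orbit, map_mul]

theorem shift_symm_site (n : ℤ) (A : Matrix (Fin d) (Fin d) ℂ) :
    (shift d).symm (site n A) = site (n - 1) A := by
  rw [StarAlgEquiv.symm_apply_eq, shift_site, sub_add_cancel]

theorem site_mem_region {s : Set ℤ} {n : ℤ} (hn : n ∈ s) (A : Matrix (Fin d) (Fin d) ℂ) :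
    site n A ∈ region d s :=
  StarSubalgebra.le_topologicalClosure _
    (StarAlgebra.subset_adjoin ℂ _ (Set.mem_iUnion₂.2 ⟨n, hn, A, rfl⟩))

theorem site_mem_rightHalf {n : ℤ} (hn : 0 ≤ n) (A : Matrix (Fin d) (Fin d) ℂ) :
    site n A ∈ rightHalf d :=
  site_mem_region (s := {n | 0 ≤ n}) hn A

theorem site_mem_leftHalf {n : ℤ} (hn : n < 0) (A : Matrix (Fin d) (Fin d) ℂ) :
    site n A ∈ leftHalf d :=
  site_mem_region (s := {n | n < 0}) hn A

theorem map_mem_region (φ : Chain d →⋆ₐ[ℂ] Chain d) {s t : Set ℤ}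
    (hφ : ∀ n ∈ s, ∀ A, φ (site n A) ∈ region d t) {x : Chain d} (hx : x ∈ region d s) :
    φ x ∈ region d t := by
  have hle : region d s ≤ (region d t).comap φ := by
    refine StarSubalgebra.topologicalClosure_minimal (StarAlgebra.adjoin_le ?_)
      ((StarSubalgebra.isClosed_topologicalClosure _).preimage (map_continuous φ))
    intro y hy
    obtain ⟨n, hn, A, rfl⟩ := Set.mem_iUnion₂.1 hy
    exact hφ n hn A
  exact hle hx

theorem shift_mem_rightHalf {x : Chain d} (hx : x ∈ rightHalf d) : shift d x ∈ rightHalf d :=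
  map_mem_region (shift d).toStarAlgHom (fun n hn A => by
    change shift d (site n A) ∈ _
    rw [shift_site]
    exact site_mem_rightHalf (Int.add_nonneg hn zero_le_one) A) hx

theorem shift_symm_mem_leftHalf {x : Chain d} (hx : x ∈ leftHalf d) :
    (shift d).symm x ∈ leftHalf d :=
  map_mem_region (shift d).symm.toStarAlgHom (fun n hn A => by
    change (shift d).symm (site n A) ∈ _
    rw [shift_symm_site]
    exact site_mem_leftHalf ((sub_one_lt n).trans hn) A) hx

/-- Commutation of distinct sites is extended by generation and closure one variable at a time:
first a single site of `s` against the whole region `t`, then region against region. -/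
theorem commute_of_mem_region {s t : Set ℤ} (hst : Disjoint s t) {x y : Chain d}
    (hx : x ∈ region d s) (hy : y ∈ region d t) : Commute x y := by
  have h1 : ∀ n ∈ s, ∀ A, ∀ y ∈ region d t, Commute (site n A) y := by
    intro n hn A y hy
    have hle : StarAlgebra.adjoin ℂ (⋃ n ∈ t, Set.range (site (d := d) n)) ≤
        StarSubalgebra.centralizer ℂ {site n A} := by
      refine StarAlgebra.adjoin_le ?_
      intro z hz
      obtain ⟨m, hm, B, rfl⟩ := Set.mem_iUnion₂.1 hz
      have hnm : n ≠ m := fun h => Set.disjoint_left.1 hst hn (h ▸ hm)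
      rw [SetLike.mem_coe, StarSubalgebra.mem_centralizer_iff]
      rintro _ rfl
      refine ⟨site_commute hnm A B, ?_⟩
      rw [← map_star]
      exact site_commute hnm _ B
    have hcl : IsClosed {z : Chain d | site n A * z = z * site n A} :=
      isClosed_eq (by fun_prop) (by fun_prop)
    refine closure_minimal (fun z hz => ?_) hcl hy
    exact ((StarSubalgebra.mem_centralizer_iff ℂ).1 (hle hz) _ rfl).1
  have hle : StarAlgebra.adjoin ℂ (⋃ n ∈ s, Set.range (site (d := d) n)) ≤
      StarSubalgebra.centralizer ℂ (region d t : Set (Chain d)) := by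
    refine StarAlgebra.adjoin_le ?_
    intro z hz
    obtain ⟨m, hm, B, rfl⟩ := Set.mem_iUnion₂.1 hz
    rw [SetLike.mem_coe, StarSubalgebra.mem_centralizer_iff]
    exact fun w hw => ⟨(h1 m hm B w hw).symm, (h1 m hm B _ (star_mem hw)).symm⟩
  have hcl : IsClosed {z : Chain d | z * y = y * z} := isClosed_eq (by fun_prop) (by fun_prop)
  refine closure_minimal (fun z hz => ?_) hcl hx
  exact ((StarSubalgebra.mem_centralizer_iff ℂ).1 (hle hz) _ hy).1.symm

/-- A local element involves finitely many sites, so a far enough translation moves it to the left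
half. Asking this for all `l ≥ k` lets sums and products use the larger of two thresholds. -/
theorem exists_shift_symm_iterate_mem_leftHalf {x : Chain d}
    (hx : x ∈ StarAlgebra.adjoin ℂ (⋃ n ∈ (Set.univ : Set ℤ), Set.range (site (d := d) n))) :
    ∃ k : ℕ, ∀ l, k ≤ l → ((shift d).symm)^[l] x ∈ leftHalf d := by
  induction hx using StarAlgebra.adjoin_induction with
  | mem x hx =>
    obtain ⟨n, -, A, rfl⟩ := Set.mem_iUnion₂.1 hx
    refine ⟨n.toNat + 1, fun l hl => ?_⟩
    have : ((shift d).symm)^[l] (site n A) = site (n - l) A := by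
      clear hl
      induction l with
      | zero => simp
      | succ l ih =>
        rw [Function.iterate_succ_apply', ih, shift_symm_site, Nat.cast_succ, sub_sub]
    rw [this]
    exact site_mem_leftHalf (by omega) A
  | algebraMap r =>
    refine ⟨0, fun l _ => ?_⟩
    have : ((shift d).symm)^[l] (algebraMap ℂ (Chain d) r) = algebraMap ℂ (Chain d) r :=
      Function.iterate_fixed (AlgHomClass.commutes (shift d).symm.toStarAlgHom r) l
    rw [this]
    exact algebraMap_mem _ r
  | add x y _ _ hx hy =>
    obtain ⟨k, hk⟩ := hx
    obtain ⟨m, hm⟩ := hy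
    refine ⟨max k m, fun l hl => ?_⟩
    rw [iterate_map_add]
    exact add_mem (hk l (le_of_max_le_left hl)) (hm l (le_of_max_le_right hl))
  | mul x y _ _ hx hy =>
    obtain ⟨k, hk⟩ := hx
    obtain ⟨m, hm⟩ := hy
    refine ⟨max k m, fun l hl => ?_⟩
    rw [iterate_map_mul]
    exact mul_mem (hk l (le_of_max_le_left hl)) (hm l (le_of_max_le_right hl))
  | star x _ hx =>
    obtain ⟨k, hk⟩ := hx
    refine ⟨k, fun l hl => ?_⟩
    have : ((shift d).symm)^[l] (star x) = star (((shift d).symm)^[l] x) :=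
      Function.Commute.iterate_left (g := star) (fun z => map_star (shift d).symm z) l x
    rw [this]
    exact star_mem (hk l hl)

end Covariance

/-! ### Cyclic subspaces and their translates -/

section Cyclic

variable {H : Type*} [NormedAddCommGroup H] [InnerProductSpace ℂ H]

theorem cyclicSubspace_mono {M N : Set (H →L[ℂ] H)} (h : M ⊆ N) (v : H) :
    cyclicSubspace M v ≤ cyclicSubspace N v :=
  Submodule.topologicalClosure_mono (Submodule.span_mono (Set.image_mono h))

theorem apply_mem_cyclicSubspace {M : Set (H →L[ℂ] H)} {T : H →L[ℂ] H} (hT : T ∈ M) (v : H) :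
    T v ∈ cyclicSubspace M v :=
  Submodule.le_topologicalClosure _ (Submodule.subset_span ⟨T, hT, rfl⟩)

theorem map_mem_cyclicSubspace {M : Set (H →L[ℂ] H)} {v : H} (R : H →L[ℂ] H)
    (hR : ∀ T ∈ M, R (T v) ∈ cyclicSubspace M v) {x : H} (hx : x ∈ cyclicSubspace M v) :
    R x ∈ cyclicSubspace M v := by
  have hle : cyclicSubspace M v ≤ (cyclicSubspace M v).comap (R : H →ₗ[ℂ] H) := by
    refine Submodule.topologicalClosure_minimal _ (Submodule.span_le.2 ?_)
      ((Submodule.isClosed_topologicalClosure _).preimage R.continuous)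
    rintro _ ⟨T, hT, rfl⟩
    exact hR T hT
  exact hle hx

/-- The subspaces `Sⁿ K`, `n ∈ ℤ`. -/
def translate (S : H ≃ₗᵢ[ℂ] H) (K : Submodule ℂ H) (n : ℤ) : Submodule ℂ H :=
  K.map ((S ^ n).toLinearEquiv : H →ₗ[ℂ] H)

instance (S : H ≃ₗᵢ[ℂ] H) (K : Submodule ℂ H) [K.HasOrthogonalProjection] (n : ℤ) :
    (translate S K n).HasOrthogonalProjection :=
  inferInstanceAs ((K.map ((S ^ n).toLinearEquiv : H →ₗ[ℂ] H)).HasOrthogonalProjection)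

theorem mem_translate_iff {S : H ≃ₗᵢ[ℂ] H} {K : Submodule ℂ H} {n : ℤ} {x : H} :
    x ∈ translate S K n ↔ (S ^ n).symm x ∈ K :=
  Submodule.mem_map_equiv (e := (S ^ n).toLinearEquiv) K

theorem translate_zero (S : H ≃ₗᵢ[ℂ] H) (K : Submodule ℂ H) : translate S K 0 = K := by
  ext x
  rw [mem_translate_iff]
  rfl

theorem apply_mem_translate_iff {S : H ≃ₗᵢ[ℂ] H} {K : Submodule ℂ H} (n : ℤ) (x : H) :
    S x ∈ translate S K (n + 1) ↔ x ∈ translate S K n := by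
  have h : (S ^ (n + 1)).symm (S x) = (S ^ n).symm x := by
    rw [LinearIsometryEquiv.symm_apply_eq, zpow_add_one_apply, LinearIsometryEquiv.apply_symm_apply]
  rw [mem_translate_iff, mem_translate_iff, h]

theorem monotone_translate {S : H ≃ₗᵢ[ℂ] H} {K : Submodule ℂ H} (hK : ∀ x ∈ K, S.symm x ∈ K) :
    Monotone (translate S K) := by
  refine monotone_int_of_le_succ fun n x hx => ?_
  rw [mem_translate_iff] at hx ⊢
  have h : (S ^ (n + 1)).symm x = S.symm ((S ^ n).symm x) := by
    rw [LinearIsometryEquiv.symm_apply_eq, zpow_add_one]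
    change x = (S ^ n) (S (S.symm ((S ^ n).symm x)))
    simp
  rw [h]
  exact hK _ hx

theorem mem_translate_of_apply_eq {S : H ≃ₗᵢ[ℂ] H} {K : Submodule ℂ H} {v : H} (hSv : S v = v)
    (hv : v ∈ K) (n : ℤ) : v ∈ translate S K n := by
  induction n using Int.induction_on with
  | zero => rwa [translate_zero]
  | succ i ih => rw [← hSv]; exact (apply_mem_translate_iff _ _).2 ih
  | pred i ih =>
    rw [← apply_mem_translate_iff, hSv, sub_add_cancel]
    exact ih

theorem filtration_starProjection [CompleteSpace H] (S : H ≃ₗᵢ[ℂ] H) (K : Submodule ℂ H)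
    [K.HasOrthogonalProjection] :
    filtration S K.starProjection = fun n => (translate S K n).starProjection := by
  ext n x
  exact (Submodule.starProjection_map_apply (S ^ n) K x).symm

end Cyclic

/-! ### The index of the two filtrations -/

section Index

variable {d : ℕ} {ω : Chain d →ₚ[ℂ] ℂ}

/-- The translates of `K` contain `π(y)Ω` for every local `y`, because some power of `θ⁻¹` moves `y`
into the left half. These vectors are dense. -/
theorem eq_zero_of_mem_orthogonal_translate (h : IsTranslationInvariant ω)
    {K : Submodule ℂ ω.GNS} (hK : ∀ y ∈ leftHalf d, orbit ω y ∈ K) {z : ω.GNS}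
    (hz : ∀ n, z ∈ (translate (shiftUnitary h) K n)ᗮ) : z = 0 := by
  have hloc : ∀ y ∈ StarAlgebra.adjoin ℂ (⋃ n ∈ (Set.univ : Set ℤ), Set.range (site (d := d) n)),
      ⟪orbit ω y, z⟫_ℂ = 0 := by
    intro y hy
    obtain ⟨k, hk⟩ := exists_shift_symm_iterate_mem_leftHalf hy
    refine hz k _ ?_
    have hmem : ∀ l : ℕ, ∀ y, ((shift d).symm)^[l] y ∈ leftHalf d →
        orbit ω y ∈ translate (shiftUnitary h) K l := by
      intro l
      induction l with
      | zero =>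
        intro y hy
        rw [Nat.cast_zero, translate_zero]
        exact hK y hy
      | succ l ih =>
        intro y hy
        have hSy : shiftUnitary h (orbit ω ((shift d).symm y)) = orbit ω y := by
          rw [shiftUnitary_orbit, StarAlgEquiv.apply_symm_apply]
        rw [← hSy, Nat.cast_succ, apply_mem_translate_iff]
        exact ih _ hy
    exact hmem k y (hk k le_rfl)
  have hall : ∀ y, ⟪orbit ω y, z⟫_ℂ = 0 := by
    intro y
    have hc := continuous_orbit ω
    have hcl : IsClosed {y : Chain d | ⟪orbit ω y, z⟫_ℂ = 0} :=
      isClosed_eq (by fun_prop) continuous_const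
    have hy : y ∈ region d Set.univ := by rw [region_univ]; trivial
    exact closure_minimal hloc hcl hy
  have hzz : (fun ψ : ω.GNS => ⟪ψ, z⟫_ℂ) = fun _ => 0 :=
    (denseRange_orbit ω).equalizer (by fun_prop) (by fun_prop) (funext hall)
  exact inner_self_eq_zero.1 (congrFun hzz z)

theorem not_finiteDimensional_wandering (hd : 2 ≤ d) (hω : ω 1 = 1)
    (h : IsTranslationInvariant ω) {K : Submodule ℂ ω.GNS} [K.HasOrthogonalProjection]
    (hgns : ∀ x ∈ leftHalf d, ∀ ψ ∈ K, ω.gnsStarAlgHom x ψ ∈ K)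
    (hmono : Monotone (translate (shiftUnitary h) K))
    (hbot : ∀ x, Filter.Tendsto
      (fun n : ℤ => (translate (shiftUnitary h) K n).starProjection x) Filter.atBot
      (nhds (InnerProductSpace.rankOne ℂ (vac ω) (vac ω) x)))
    (htop : ∀ z, (∀ n, z ∈ (translate (shiftUnitary h) K n)ᗮ) → z = 0) :
    ¬ FiniteDimensional ℂ
      ↥(translate (shiftUnitary h) K 0 ⊓ (translate (shiftUnitary h) K (-1))ᗮ) := by
  -- The sites `-2, -3, …`: site `-1` is left out so that one step to the right still ends in the
  -- left half, which gives invariance of `S⁻¹ K` as well as of `K`.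
  set ρ : ℕ → Matrix (Fin d) (Fin d) ℂ →ₐ[ℂ] (ω.GNS →L[ℂ] ω.GNS) := fun n =>
    (ω.gnsStarAlgHom.comp (site (-n - 2))).toAlgHom with hρ
  have hρc : ∀ m n, m ≠ n → ∀ A B, Commute (ρ m A) (ρ n B) := fun m n hmn A B =>
    (site_commute (show (-m - 2 : ℤ) ≠ -n - 2 by omega) A B).map ω.gnsStarAlgHom
  have hρ0 : ∀ n A, ∀ x ∈ K, ρ n A x ∈ K := fun n A =>
    hgns (site (-n - 2) A) (site_mem_leftHalf (by omega) A)
  have hρ1 : ∀ n A, ∀ x ∈ translate (shiftUnitary h) K (-1), ρ n A x ∈ translate (shiftUnitary h) K (-1) := by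
    intro n A x hx
    rw [← apply_mem_translate_iff, neg_add_cancel, translate_zero] at hx ⊢
    change shiftUnitary h (ω.gnsStarAlgHom (site (-n - 2) A) x) ∈ K
    rw [shiftUnitary_gns, shift_site]
    exact hgns (site (-n - 2 + 1) A) (site_mem_leftHalf (by omega) A) _ hx
  -- The orthogonal complement is invariant because each matrix algebra is closed under adjoints.
  have hρ2 : ∀ n A, ∀ x ∈ (translate (shiftUnitary h) K (-1))ᗮ, ρ n A x ∈ (translate (shiftUnitary h) K (-1))ᗮ := by
    intro n A x hx u hu
    have hadj : ⟪u, ρ n A x⟫_ℂ = ⟪ρ n (star A) u, x⟫_ℂ := by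
      change ⟪u, ω.gnsStarAlgHom (site (-n - 2) A) x⟫_ℂ
        = ⟪ω.gnsStarAlgHom (site (-n - 2) (star A)) u, x⟫_ℂ
      rw [map_star, map_star, ContinuousLinearMap.star_eq_adjoint,
        ContinuousLinearMap.adjoint_inner_left]
    rw [hadj]
    exact hx _ (hρ1 n _ u hu)
  intro hfin
  have hW := eq_bot_of_finiteDimensional_of_invariant hd ρ hρc
    (translate (shiftUnitary h) K 0 ⊓ (translate (shiftUnitary h) K (-1))ᗮ) 0 fun n _ A x hx =>
    ⟨by rw [translate_zero] at hx ⊢; exact hρ0 n A x hx.1, hρ2 n A x hx.2⟩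
  -- The wandering space is zero, so the filtration does not grow from `-1` to `0`, and by
  -- translation nowhere.
  have hle : translate (shiftUnitary h) K 0 ≤ translate (shiftUnitary h) K (-1) := by
    intro x hx
    have hmem : x - (translate (shiftUnitary h) K (-1)).starProjection x ∈
        translate (shiftUnitary h) K 0 ⊓ (translate (shiftUnitary h) K (-1))ᗮ :=
      ⟨sub_mem hx (hmono (by omega) (Submodule.starProjection_apply_mem _ _)),
        Submodule.sub_starProjection_mem_orthogonal _⟩
    rw [hW, Submodule.mem_bot, sub_eq_zero] at hmem
    rw [hmem]
    exact Submodule.starProjection_apply_mem _ _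
  have hconst : ∀ n, translate (shiftUnitary h) K n = K := by
    have hstep : ∀ n, translate (shiftUnitary h) K (n + 1) = translate (shiftUnitary h) K n := by
      intro n
      refine le_antisymm (fun x hx => ?_) (hmono (by omega))
      have h1 := zpow_apply_mem_iff (S := shiftUnitary h) (K := translate (shiftUnitary h) K)
        apply_mem_translate_iff (n + 1) 0 ((shiftUnitary h ^ (n + 1)).symm x)
      have h2 := zpow_apply_mem_iff (S := shiftUnitary h) (K := translate (shiftUnitary h) K)
        apply_mem_translate_iff (n + 1) (-1) ((shiftUnitary h ^ (n + 1)).symm x)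
      rw [LinearIsometryEquiv.apply_symm_apply] at h1 h2
      rw [zero_add] at h1
      rw [neg_add_cancel_comm_assoc] at h2
      exact h2.2 (hle (h1.1 hx))
    intro n
    induction n using Int.induction_on with
    | zero => exact translate_zero _ K
    | succ i ih => rw [hstep, ih]
    | pred i ih => rw [← hstep, sub_add_cancel, ih]
  -- A constant filtration is everything by density of the union, while its limit at `-∞` is the
  -- projection onto `ℂΩ`. So the GNS space is at most one-dimensional.
  have hall : ∀ z : ω.GNS, z ∈ ℂ ∙ vac ω := by
    intro z
    have hzK : z ∈ K := by
      have h0 := htop (z - K.starProjection z) fun n => by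
        rw [hconst]
        exact Submodule.sub_starProjection_mem_orthogonal _
      rw [sub_eq_zero.1 h0]
      exact Submodule.starProjection_apply_mem _ _
    have h1 := hbot z
    have h2 : ∀ n, (translate (shiftUnitary h) K n).starProjection z = z := fun n =>
      Submodule.starProjection_eq_self_iff.2 (by rwa [hconst])
    simp only [h2] at h1
    rw [tendsto_nhds_unique tendsto_const_nhds h1, InnerProductSpace.rankOne_apply]
    exact Submodule.smul_mem _ _ (Submodule.mem_span_singleton_self _)
  have hspan := eq_bot_of_finiteDimensional_of_invariant hd ρ hρc (ℂ ∙ vac ω) 0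
    fun n _ A x _ => hall _
  have hv0 : vac ω = 0 := by
    have := Submodule.mem_span_singleton_self (R := ℂ) (vac ω)
    rwa [hspan, Submodule.mem_bot] at this
  have := norm_vac ω hω
  rw [hv0, norm_zero] at this
  exact zero_ne_one this

/-- What `π(B_R)'` and `π(B_L)''` share: containing `π(B_L)` gives density of the union, being
multiplicative gives invariance under the left sites, and stability under `T ↦ S⁻¹ T S` gives
monotonicity. -/
theorem isMackeyIndex_cyclicProj_iff (hd : 2 ≤ d) (hω : ω 1 = 1) (h : IsTranslationInvariant ω)
    {N : Set (ω.GNS →L[ℂ] ω.GNS)} (hN : ω.gnsStarAlgHom '' leftHalf d ⊆ N)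
    (hmul : ∀ T ∈ N, ∀ R ∈ N, T * R ∈ N)
    (hconj : ∀ T ∈ N, (shiftUnitary h).symm.conjStarAlgEquiv T ∈ N)
    (hlim : ∀ ψ, Filter.Tendsto
      (fun n : ℤ => filtration (shiftUnitary h) (cyclicProj N (vac ω)) n ψ) Filter.atBot
      (nhds (InnerProductSpace.rankOne ℂ (vac ω) (vac ω) ψ))) (κ : Cardinal.{0}) :
    IsMackeyIndex (shiftUnitary h) (vac ω)
      (filtration (shiftUnitary h) (cyclicProj N (vac ω))) κ ↔ κ = Cardinal.aleph0 := by
  have := separableSpace_gns ω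
  set S := shiftUnitary h with hSdef
  set K := cyclicSubspace N (vac ω) with hK
  have hSv : S (vac ω) = vac ω := shiftUnitary_vac h
  have hSv' : S.symm (vac ω) = vac ω := by rw [LinearIsometryEquiv.symm_apply_eq, hSv]
  have hone : (1 : ω.GNS →L[ℂ] ω.GNS) ∈ N := hN ⟨1, one_mem _, map_one _⟩
  have hvac : vac ω ∈ K := apply_mem_cyclicSubspace hone (vac ω)
  have hsymm : ∀ x ∈ K, S.symm x ∈ K := fun x hx =>
    map_mem_cyclicSubspace (S.symm : ω.GNS →L[ℂ] ω.GNS) (fun T hT => by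
      have := apply_mem_cyclicSubspace (hconj T hT) (vac ω)
      rw [LinearIsometryEquiv.conjStarAlgEquiv_apply_apply, LinearIsometryEquiv.symm_symm,
        hSv] at this
      exact this) hx
  have hmono := monotone_translate hsymm
  have hvK : ∀ n, vac ω ∈ translate S K n := mem_translate_of_apply_eq hSv hvac
  have hgns : ∀ x ∈ leftHalf d, ∀ ψ ∈ K, ω.gnsStarAlgHom x ψ ∈ K := fun x hx ψ hψ =>
    map_mem_cyclicSubspace _ (fun T hT =>
      apply_mem_cyclicSubspace (hmul _ (hN ⟨x, hx, rfl⟩) T hT) (vac ω)) hψ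
  have htop : ∀ z, (∀ n, z ∈ (translate S K n)ᗮ) → z = 0 :=
    fun z => eq_zero_of_mem_orthogonal_translate h fun y hy =>
      apply_mem_cyclicSubspace (hN ⟨y, hy, rfl⟩) (vac ω)
  have hbot : ∀ x, Filter.Tendsto (fun n : ℤ => (translate S K n).starProjection x) Filter.atBot
      (nhds (InnerProductSpace.rankOne ℂ (vac ω) (vac ω) x)) := by
    intro x
    have := hlim x
    rw [cyclicProj, filtration_starProjection] at this
    exact this
  have hinf := not_finiteDimensional_wandering hd hω h hgns hmono hbot htop
  rw [cyclicProj, filtration_starProjection]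
  refine ⟨mk_eq_aleph0_of_isMackeyIndex hvK hinf, ?_⟩
  rintro rfl
  obtain ⟨κ, hκ⟩ := exists_isMackeyIndex hvK hmono apply_mem_translate_iff hbot htop
  rwa [← mk_eq_aleph0_of_isMackeyIndex hvK hinf hκ]

theorem conj_symm_mem_centralizer (S : ω.GNS ≃ₗᵢ[ℂ] ω.GNS) {M : Set (ω.GNS →L[ℂ] ω.GNS)}
    (hM : ∀ T ∈ M, S.conjStarAlgEquiv T ∈ M) {T : ω.GNS →L[ℂ] ω.GNS}
    (hT : T ∈ Set.centralizer M) : S.symm.conjStarAlgEquiv T ∈ Set.centralizer M := by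
  intro R hR
  have h := congrArg S.symm.conjStarAlgEquiv (hT _ (hM R hR))
  have hR' : S.symm.conjStarAlgEquiv (S.conjStarAlgEquiv R) = R := by
    ext x
    simp
  rwa [map_mul, map_mul, hR'] at h

theorem gns_leftHalf_subset_centralizer :
    ω.gnsStarAlgHom '' leftHalf d ⊆ Set.centralizer (ω.gnsStarAlgHom '' rightHalf d) := by
  rintro _ ⟨x, hx, rfl⟩ _ ⟨y, hy, rfl⟩
  refine (commute_of_mem_region ?_ hy hx).map ω.gnsStarAlgHom
  exact Set.disjoint_left.2 fun n (hn : 0 ≤ n) (hn' : n < 0) => hn.not_gt hn'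

theorem conj_gns (h : IsTranslationInvariant ω) (x : Chain d) :
    (shiftUnitary h).conjStarAlgEquiv (ω.gnsStarAlgHom x) = ω.gnsStarAlgHom (shift d x) := by
  ext ψ
  rw [LinearIsometryEquiv.conjStarAlgEquiv_apply_apply, shiftUnitary_gns,
    LinearIsometryEquiv.apply_symm_apply]

theorem conj_symm_gns (h : IsTranslationInvariant ω) (x : Chain d) :
    (shiftUnitary h).symm.conjStarAlgEquiv (ω.gnsStarAlgHom x)
      = ω.gnsStarAlgHom ((shift d).symm x) := by
  ext ψ
  rw [LinearIsometryEquiv.conjStarAlgEquiv_apply_apply, LinearIsometryEquiv.symm_apply_eq,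
    shiftUnitary_gns, LinearIsometryEquiv.symm_symm, StarAlgEquiv.apply_symm_apply]

/-- The left filtration lies below the filtration of the support projections. -/
theorem tendsto_filtration_leftProj {h : IsTranslationInvariant ω} (hK : IsKolmogorov h)
    (ψ : ω.GNS) :
    Filter.Tendsto (fun n : ℤ => filtration (shiftUnitary h) (leftProj ω) n ψ) Filter.atBot
      (nhds (InnerProductSpace.rankOne ℂ (vac ω) (vac ω) ψ)) := by
  set S := shiftUnitary h with hS
  set KE := cyclicSubspace (Set.centralizer (ω.gnsStarAlgHom '' rightHalf d)) (vac ω) with hKE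
  set KF := cyclicSubspace (Set.centralizer (Set.centralizer (ω.gnsStarAlgHom '' leftHalf d)))
    (vac ω) with hKF
  -- Locality gives `π(B_L) ⊆ π(B_R)'`. Taking double commutants preserves the inclusion, and the
  -- triple commutant is the commutant.
  have hsub : Set.centralizer (Set.centralizer (ω.gnsStarAlgHom '' leftHalf d))
      ⊆ Set.centralizer (ω.gnsStarAlgHom '' rightHalf d) := by
    have h1 := Set.centralizer_subset (Set.centralizer_subset
      (gns_leftHalf_subset_centralizer (ω := ω)))
    rwa [Set.centralizer_centralizer_centralizer] at h1
  have hle : ∀ n, translate S KF n ≤ translate S KE n := fun n =>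
    Submodule.map_mono (cyclicSubspace_mono hsub _)
  have hvac : ∀ n, vac ω ∈ translate S KF n :=
    mem_translate_of_apply_eq (shiftUnitary_vac h)
      (apply_mem_cyclicSubspace (T := 1) Set.one_mem_centralizer (vac ω))
  have hE := hK ψ
  rw [supportProj, cyclicProj, filtration_starProjection] at hE
  rw [leftProj, cyclicProj, filtration_starProjection]
  rw [tendsto_iff_norm_sub_tendsto_zero] at hE ⊢
  refine squeeze_zero (fun _ => norm_nonneg _) (fun n => ?_) hE
  set q := InnerProductSpace.rankOne ℂ (vac ω) (vac ω) ψ with hq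
  have hqF : (translate S KF n).starProjection q = q := by
    refine Submodule.starProjection_eq_self_iff.2 ?_
    rw [hq, InnerProductSpace.rankOne_apply]
    exact Submodule.smul_mem _ _ (hvac n)
  have hFE : (translate S KF n).starProjection ((translate S KE n).starProjection ψ)
      = (translate S KF n).starProjection ψ :=
    congrArg (fun T : ω.GNS →L[ℂ] ω.GNS => T ψ)
      (Submodule.starProjection_comp_starProjection_of_le (hle n))
  -- Since `F_n ≤ E_n` and `F_n` fixes the limit `q`, the error for `F_n` is the image under the
  -- contraction `F_n` of the error for `E_n`.
  calc ‖(translate S KF n).starProjection ψ - q‖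
      = ‖(translate S KF n).starProjection ((translate S KE n).starProjection ψ - q)‖ := by
        rw [map_sub, hFE, hqF]
    _ ≤ ‖(translate S KE n).starProjection ψ - q‖ :=
        ((translate S KF n).starProjection.le_opNorm _).trans
          (mul_le_of_le_one_left (norm_nonneg _) (Submodule.starProjection_norm_le _))

end Index

end SpinChain

theorem proposition4p1 (d : ℕ) (hd : 2 ≤ d) (ω : SpinChain.Chain d →ₚ[ℂ] ℂ) (hω : ω 1 = 1)
    (hinv : SpinChain.IsTranslationInvariant ω) (hK : SpinChain.IsKolmogorov hinv) :
    (∀ κ : Cardinal.{0},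
      SpinChain.IsMackeyIndex (SpinChain.shiftUnitary hinv) (SpinChain.vac ω)
        (SpinChain.filtration (SpinChain.shiftUnitary hinv) (SpinChain.supportProj ω)) κ ↔
      κ = Cardinal.aleph0) ∧
    (∀ κ : Cardinal.{0},
      SpinChain.IsMackeyIndex (SpinChain.shiftUnitary hinv) (SpinChain.vac ω)
        (SpinChain.filtration (SpinChain.shiftUnitary hinv) (SpinChain.leftProj ω)) κ ↔
      κ = Cardinal.aleph0) := by
  refine ⟨SpinChain.isMackeyIndex_cyclicProj_iff hd hω hinv
    SpinChain.gns_leftHalf_subset_centralizer (fun T hT R hR => Set.mul_mem_centralizer hT hR)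
    (fun T hT => SpinChain.conj_symm_mem_centralizer _ ?_ hT) hK,
    SpinChain.isMackeyIndex_cyclicProj_iff hd hω hinv Set.subset_centralizer_centralizer
    (fun T hT R hR => Set.mul_mem_centralizer hT hR)
    (fun T hT => SpinChain.conj_symm_mem_centralizer _ (fun R hR => ?_) hT)
    (SpinChain.tendsto_filtration_leftProj hK)⟩
  · rintro _ ⟨x, hx, rfl⟩
    rw [SpinChain.conj_gns]
    exact ⟨_, SpinChain.shift_mem_rightHalf hx, rfl⟩
  -- Each commutant reverses the direction: `θ⁻¹` preserves `B_L`, so conjugation by `S` preserves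
  -- `π(B_L)'`, and conjugation by `S⁻¹` preserves `π(B_L)''`.
  · refine SpinChain.conj_symm_mem_centralizer (SpinChain.shiftUnitary hinv).symm ?_ hR
    rintro _ ⟨x, hx, rfl⟩
    rw [SpinChain.conj_symm_gns]
    exact ⟨_, SpinChain.shift_symm_mem_leftHalf hx, rfl⟩
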